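/- A problem is a partial multifunction $f:\subseteq\mathbb{N}^{\mathbb{N}}\rightrightarrows\mathbb{N}^{\mathbb{N}}$, with $\operatorname{dom}(f)=\{x : f(x)\neq\emptyset\}$; natural numbers and finite tuples are coded in $\mathbb{N}^{\mathbb{N}}$ in the usual way. A partial function $F:\subseteq\mathbb{N}^{\mathbb{N}}\to\mathbb{N}^{\mathbb{N}}$ is a realizer of $f$ if $F(x)$ is defined and $F(x)\in f(x)$ for every $x\in\operatorname{dom}(f)$. Write $g\leq_{\mathrm W} f$ ($g$ is Weihrauch reducible to $f$) if there are computable functionals $H,K:\subseteq\mathbb{N}^{\mathbb{N}}\to\mathbb{N}^{\mathbb{N}}$ such that $x\mapsto K\langle F(H(x)),x\rangle$ is a realizer of $g$ whenever $F$ is a realizer of $f$. For $k\geq 1$ let $\mathsf{cRT}^1_k$ be the problem whose inputs are the colourings $p:\mathbb{N}\to\{0,\dots,k-1\}$ and whose outputs on input $p$ are the colours $j<k$ such that $p(i)=j$ for infinitely many $i$. Let $\mathsf{TC}_{\mathbb{N}}$ be the problem that takes as input an enumeration of an arbitrary set $A\subseteq\mathbb{N}$ ($A=\emptyset$ and $A=\mathbb{N}$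 allowed) and for which $n\in\mathbb{N}$ is a correct output if and only if $n\notin A$ or $A=\mathbb{N}$. For $m\in\mathbb{N}$ let $\mathsf{TC}_{\mathbb{N}}^m$ be its $m$-fold parallel product: given $m$ inputs of $\mathsf{TC}_{\mathbb{N}}$, return a correct output for each of them (so $\mathsf{TC}_{\mathbb{N}}^0$ is trivially solvable, equivalent to $\mathrm{id}$). **Theorem.** For all $k,m\in\mathbb{N}$, $$\mathsf{cRT}^1_{k+1}\leq_{\mathrm W}\mathsf{TC}_{\mathbb{N}}^m\quad\text{if and only if}\quad k\leq m .$$ -/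

import Mathlib

namespace Weihrauch

/-- Baire space `ℕ^ℕ`; its elements serve as names of the objects of concern. -/
abbrev Baire : Type := ℕ → ℕ

/-- The word consisting of the first `n` entries of `p`. -/
def pre (p : Baire) (n : ℕ) : List ℕ := (List.range n).map p

/-- A partial function `F : ⊆ ℕ^ℕ → ℕ^ℕ` is a computable functional if there is a computable
function `h` on finite words, monotone for the prefix order, such that for every `p` in the domain
of `F` the words `h (pre p 0), h (pre p 1), …` are prefixes of `F p` of unbounded length, that is
`F p = sup_k h (pre p k)`. (Thus `h w` is what a machine with a one-way output tape has written
when it has read the word `w`.) -/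
def ComputableFunctional (F : Baire →. Baire) : Prop :=
  ∃ h : List ℕ → List ℕ, Computable h ∧
    (∀ u v : List ℕ, u <+: v → h u <+: h v) ∧
    ∀ p q : Baire, q ∈ F p →
      (∀ k : ℕ, h (pre p k) = pre q (h (pre p k)).length) ∧
      (∀ n : ℕ, ∃ k : ℕ, n ≤ (h (pre p k)).length)

/-- A problem, i.e. a partial multifunction `f : ⊆ ℕ^ℕ ⇉ ℕ^ℕ`, given by its sets of values. -/
abbrev Problem : Type := Baire → Set Baire

/-- The domain of a partial multifunction: the inputs that have at least one output. -/
def Problem.dom (f : Problem) : Set Baire := {x | (f x).Nonempty}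

/-- The partial function `F` is a realizer of `f`: for all `x ∈ dom f`, `F x` is defined and
belongs to `f x`. -/
def Realizes (F : Baire →. Baire) (f : Problem) : Prop :=
  ∀ x ∈ f.dom, ∃ y ∈ F x, y ∈ f x

/-- The standard pairing `⟨p, q⟩ = (p 0, q 0, p 1, q 1, …)` on Baire space. -/
def pair (p q : Baire) : Baire := fun n => if n % 2 = 0 then p (n / 2) else q (n / 2)

/-- Weihrauch reducibility `g ≤_W f`: there are computable functionals `H` and `K` such that
`K ⟨F H, id⟩` is a realizer of `g` whenever `F` is a realizer of `f`. -/
def WeihrauchReducible (g f : Problem) : Prop :=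
  ∃ H K : Baire →. Baire, ComputableFunctional H ∧ ComputableFunctional K ∧
    ∀ F : Baire →. Baire, Realizes F f →
      Realizes (fun x => (H x).bind fun y => (F y).bind fun z => K (pair z x)) g

/-- The `i`-th of the `m` sequences that `p` codes by interleaving:
`p = (p₀ 0, …, p_{m-1} 0, p₀ 1, …, p_{m-1} 1, …)`. For `m = 2` this is inverse to `pair`. -/
def component (m : ℕ) (i : Fin m) (p : Baire) : Baire := fun n => p (m * n + i)

/-- The `m`-fold parallel product `f^m = f × ⋯ × f`: given `m` instances of `f`, solve all of
them. For `m = 0` every input is (a name of) the empty tuple, and every output is correct. -/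
def power (f : Problem) (m : ℕ) : Problem :=
  fun p => {q | ∀ i : Fin m, component m i q ∈ f (component m i p)}

/-- The set of natural numbers enumerated by `e`: an entry `n + 1` puts `n` into the set, and an
entry `0` gives no information, so that every subset of `ℕ`, also `∅`, has an enumeration. -/
def enumerated (e : Baire) : Set ℕ := {n | ∃ i, e i = n + 1}

/-- Totalization of closed choice on `ℕ`: given an enumeration of any `A ⊆ ℕ`, output some
`n ∉ A` if `A ≠ ℕ`, and any `n` if `A = ℕ`. A name of `n ∈ ℕ` is any `q` with `q 0 = n`. -/
def TCN : Problem :=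
  fun e => {q | q 0 ∉ enumerated e ∨ enumerated e = Set.univ}

/-- Ramsey's theorem for singletons, colour version (`cRT¹_k`): given a colouring
`p : ℕ → {0, …, k - 1}`, output a colour that occurs infinitely often in `p`.
A name of the colour `j` is any `q` with `q 0 = j`. -/
def cRT (k : ℕ) : Problem :=
  fun p => {q | (∀ i, p i < k) ∧ q 0 < k ∧ {i | p i = q 0}.Infinite}

end Weihrauch

/-!
A colouring has at least one colour that occurs infinitely often; both directions of the theorem
come down to the amount of information about these colours that a single instance of `TCN` carries.

*Reduction for `k ≤ m`.* One instance of `TCN` compares two sets of colours: enumerate an even `v`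
once a colour of the first set is seen at a position `≥ v`, and an odd `v` once this happens for the
second set. If the answer `n` is even, then the first set occurs only finitely often, or both sets
occur infinitely often; symmetrically for odd `n`. The `i`-th instance compares `{0, …, i}` with
`{i + 1}`. Going down from `i = m - 1`, the invariant "one of the colours `0, …, i + 1` occurs
infinitely often" passes to `{0, …, i}` as long as the answers are odd, and the first even answer
shows that the colour `i + 1` occurs infinitely often (`infinite_lastEven`).

*No reduction for `m < k`.* Only continuity of `H` and `K` matters. For a finite word (an initial
segment of a colouring `x`) and a set `C` of colours, consider the colourings that extend the word
by colours from `C` (`extensions`). Suppose that `n` is never enumerated into the `i`-th set by the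
colourings in some such set of extensions: then `n` is a correct `i`-th answer on all of it, and the
`i`-th instance is of no more use. Each time this happens at most one colour is given up, so at
least two colours remain in the end. For the instances that are still active, every set of
extensions, even after one more colour has been given up, contains by the Baire category theorem a
colouring for which all these instances enumerate `ℕ`, so that every answer is correct for them.
Hence a fixed tuple of answers is correct for a colouring in every such set. From it `K` commits
itself to a colour `c` after reading finitely many entries; giving up `c` from then on yields a
colouring in which `c` occurs only finitely often although the answers are still correct
(`no_reduction_of_extensions`).
-/

open Set

namespace Weihrauch

/-! ### Prefixes and local functionals -/

theorem length_pre (p : Baire) (n : ℕ) : (pre p n).length = n := by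
  simp [pre]

theorem getElem?_pre {p : Baire} {n i : ℕ} (h : i < n) : (pre p n)[i]? = some (p i) := by
  simp [pre, h]

theorem getD_pre {p : Baire} {n i d : ℕ} (h : i < n) : (pre p n).getD i d = p i := by
  simp [List.getD, getElem?_pre h]

theorem pre_congr {p q : Baire} {n : ℕ} (h : ∀ i < n, p i = q i) : pre p n = pre q n :=
  List.map_congr_left fun i hi => h i (List.mem_range.1 hi)

theorem pre_prefix (p : Baire) {m n : ℕ} (h : m ≤ n) : pre p m <+: pre p n := by
  rw [List.prefix_iff_eq_take, length_pre, pre, pre, ← List.map_take, List.take_range,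
    min_eq_left h]

theorem getD_eq_of_prefix {u v : List ℕ} (h : u <+: v) {i d : ℕ} (hi : i < u.length) :
    u.getD i d = v.getD i d := by
  obtain ⟨w, rfl⟩ := h
  rw [List.getD_append _ _ _ _ hi]

/-- A total functional is computable if its `t`-th output entry is given, uniformly in `t`, by a
primitive recursive function of the input that only looks at the entries up to `t + N`. -/
theorem computableFunctional_of_local (G : ℕ → List ℕ → ℕ) (hG : Primrec₂ G) (N : ℕ)
    (hloc : ∀ t u v, u <+: v → t + N < u.length → G t u = G t v) :
    ComputableFunctional (fun p => Part.some fun t => G t (pre p (t + N + 1))) := by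
  refine ⟨fun w => (List.range (w.length - N)).map fun t => G t w, ?_, ?_, ?_⟩
  · refine Primrec.to_comp (Primrec.list_map (Primrec.list_range.comp
      (Primrec.nat_sub.comp Primrec.list_length (Primrec.const N))) ?_)
    exact hG.comp Primrec.snd Primrec.fst
  · intro u v huv
    have hl := huv.length_le
    have hu : (List.range (u.length - N)).map (fun t => G t u)
        = (List.range (u.length - N)).map fun t => G t v :=
      List.map_congr_left fun t ht => hloc t u v huv (by
        have := List.mem_range.1 ht
        omega)
    simp only [hu]
    exact pre_prefix (fun t => G t v) (by omega)
  · intro p q hq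
    obtain rfl := Part.mem_some_iff.1 hq
    refine ⟨fun l => ?_, fun n => ⟨n + N, by simp [length_pre]⟩⟩
    simp only [List.length_map, List.length_range, length_pre]
    refine List.map_congr_left fun t ht => ?_
    have := List.mem_range.1 ht
    exact (hloc t _ _ (pre_prefix p (by omega)) (by rw [length_pre]; omega)).symm

/-! ### Solvability of the problems -/

theorem TCN_nonempty (e : Baire) : (TCN e).Nonempty := by
  by_cases h : enumerated e = univ
  · exact ⟨0, Or.inr h⟩
  · obtain ⟨n, hn⟩ := (ne_univ_iff_exists_notMem _).1 h
    exact ⟨fun _ => n, Or.inl hn⟩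

/-- Interleaving of `m` answers, each named by a sequence that is zero after its first entry. -/
def answerName {m : ℕ} (N : Fin m → ℕ) : Baire := fun t => if h : t < m then N ⟨t, h⟩ else 0

theorem component_answerName_zero {m : ℕ} (N : Fin m → ℕ) (i : Fin m) :
    component m i (answerName N) 0 = N i := by
  simp [component, answerName]

/-- Whether `q` solves an instance of `TCN` depends on `q 0` only. -/
theorem mem_TCN_congr {e q r : Baire} (h : q 0 = r 0) : q ∈ TCN e ↔ r ∈ TCN e := by
  simp only [TCN, mem_ofPred_eq, h]

theorem power_TCN_nonempty (m : ℕ) (p : Baire) : (power TCN m p).Nonempty := by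
  choose q hq using fun i : Fin m => TCN_nonempty (component m i p)
  exact ⟨answerName fun i => q i 0, fun i =>
    (mem_TCN_congr (component_answerName_zero _ i)).2 (hq i)⟩

/-! ### The reduction -/

/-- The entry `t = m * n + i` of the instances of `TCN` computed from the colouring `w`: if `n`
codes the pair `(v, s)`, then the `i`-th instance enumerates `v` at stage `n` if `s ≥ v` and
the colour of `s` is at most `i` (for even `v`) or equal to `i + 1` (for odd `v`). -/
def compareEntry (m t : ℕ) (w : List ℕ) : ℕ :=
  if (t / m).unpair.1 ≤ (t / m).unpair.2 ∧
      (((t / m).unpair.1 % 2 = 0 ∧ w.getD (t / m).unpair.2 0 ≤ t % m) ∨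
        ((t / m).unpair.1 % 2 = 1 ∧ w.getD (t / m).unpair.2 0 = t % m + 1))
  then (t / m).unpair.1 + 1 else 0

/-- The number `i + 1` for the largest `i < m` such that `a i` is even, and `0` if there is none. -/
def lastEven (a : ℕ → ℕ) : ℕ → ℕ
  | 0 => 0
  | i + 1 => if a i % 2 = 0 then i + 1 else lastEven a i

theorem lastEven_congr {a b : ℕ → ℕ} {m : ℕ} (h : ∀ i < m, a i = b i) :
    lastEven a m = lastEven b m := by
  induction m with
  | zero => rfl
  | succ m ih => simp only [lastEven, h m (by omega), ih fun i hi => h i (by omega)]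

theorem primrec_compareEntry (m : ℕ) : Primrec₂ (compareEntry m) := by
  have hn : Primrec fun x : ℕ × List ℕ => (x.1 / m).unpair :=
    Primrec.unpair.comp (Primrec.nat_div.comp Primrec.fst (Primrec.const m))
  have hv := Primrec.fst.comp hn
  have hs := Primrec.snd.comp hn
  have hi : Primrec fun x : ℕ × List ℕ => x.1 % m :=
    Primrec.nat_mod.comp Primrec.fst (Primrec.const m)
  have hc : Primrec fun x : ℕ × List ℕ => x.2.getD (x.1 / m).unpair.2 0 :=
    (Primrec.list_getD 0).comp Primrec.snd hs
  have hp := Primrec.nat_mod.comp hv (Primrec.const 2)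
  refine Primrec.ite (PrimrecPred.and (Primrec.nat_le.comp hv hs) (PrimrecPred.or
    (PrimrecPred.and (Primrec.eq.comp hp (Primrec.const 0)) (Primrec.nat_le.comp hc hi))
    (PrimrecPred.and (Primrec.eq.comp hp (Primrec.const 1))
      (Primrec.eq.comp hc (Primrec.succ.comp hi))))) (Primrec.succ.comp hv) (Primrec.const 0)

theorem primrec_lastEven (m : ℕ) :
    Primrec fun w : List ℕ => lastEven (fun i => w.getD (2 * i) 0) m := by
  induction m with
  | zero => exact Primrec.const 0
  | succ m ih =>
    exact Primrec.ite (Primrec.eq.comp (Primrec.nat_mod.comp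
      ((Primrec.list_getD 0).comp Primrec.id (Primrec.const (2 * m))) (Primrec.const 2))
      (Primrec.const 0)) (Primrec.const (m + 1)) ih

theorem compareEntry_of_prefix (m t : ℕ) {u v : List ℕ} (h : u <+: v) (ht : t < u.length) :
    compareEntry m t u = compareEntry m t v := by
  have hs : (t / m).unpair.2 < u.length :=
    ((Nat.unpair_right_le _).trans (Nat.div_le_self _ _)).trans_lt ht
  simp only [compareEntry, getD_eq_of_prefix h hs]

/-- The interleaving of the `m` instances of `TCN` computed from the colouring `p`. -/
def compareInstances (m : ℕ) (p : Baire) : Baire := fun t => compareEntry m t (pre p (t + 0 + 1))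

theorem mem_enumerated_compareInstances {m : ℕ} (i : Fin m) (p : Baire) (v : ℕ) :
    v ∈ enumerated (component m i (compareInstances m p)) ↔
      ∃ s, v ≤ s ∧ ((v % 2 = 0 ∧ p s ≤ i) ∨ (v % 2 = 1 ∧ p s = i + 1)) := by
  have hm : 0 < m := i.pos
  have key : ∀ n, component m i (compareInstances m p) n =
      if n.unpair.1 ≤ n.unpair.2 ∧ ((n.unpair.1 % 2 = 0 ∧ p n.unpair.2 ≤ i) ∨
        (n.unpair.1 % 2 = 1 ∧ p n.unpair.2 = i + 1)) then n.unpair.1 + 1 else 0 := by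
    intro n
    have h1 : (m * n + i) / m = n := by
      rw [Nat.mul_add_div hm, Nat.div_eq_of_lt i.2, add_zero]
    have h2 : (m * n + i) % m = i := by
      rw [Nat.mul_add_mod, Nat.mod_eq_of_lt i.2]
    have h3 : n.unpair.2 < m * n + i + 0 + 1 := by
      have := Nat.unpair_right_le n
      have := Nat.le_mul_of_pos_left n hm
      omega
    simp only [component, compareInstances, compareEntry, h1, h2, getD_pre h3]
  constructor
  · rintro ⟨n, hn⟩
    rw [key] at hn
    split_ifs at hn with h
    obtain rfl : n.unpair.1 = v := by omega
    exact ⟨_, h⟩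
  · rintro ⟨s, h⟩
    refine ⟨Nat.pair v s, ?_⟩
    rw [key, Nat.unpair_pair, if_pos h]

/-- The answers to the comparisons of `{0, …, i}` with `{i + 1}` for `i < m` determine a colour
that occurs infinitely often, provided that one of the colours `0, …, m` does. -/
theorem infinite_lastEven (p a : ℕ → ℕ) (m : ℕ) (hp : {s | p s ≤ m}.Infinite)
    (heven : ∀ i < m, a i % 2 = 0 → {s | p s ≤ i}.Infinite → {s | p s = i + 1}.Infinite)
    (hodd : ∀ i < m, a i % 2 = 1 → {s | p s = i + 1}.Infinite → {s | p s ≤ i}.Infinite) :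
    {s | p s = lastEven a m}.Infinite := by
  induction m with
  | zero => simpa [lastEven] using hp
  | succ m ih =>
    have hsplit : {s | p s ≤ m + 1} = {s | p s ≤ m} ∪ {s | p s = m + 1} := by
      ext s
      simp only [mem_ofPred_eq, mem_union]
      omega
    rw [hsplit, infinite_union] at hp
    rcases Nat.mod_two_eq_zero_or_one (a m) with h | h
    · rw [lastEven, if_pos h]
      exact hp.elim (heven m m.lt_succ_self h) id
    · rw [lastEven, if_neg (by omega)]
      exact ih (hp.elim id (hodd m m.lt_succ_self h)) (fun i hi => heven i (by omega))
        fun i hi => hodd i (by omega)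

/-- A correct answer to the `i`-th comparison shows that if one of the two sets of colours occurs
infinitely often, then so does the set not selected by the parity of the answer. -/
theorem infinite_of_mem_TCN {m : ℕ} (i : Fin m) (p q : Baire)
    (hq : q ∈ TCN (component m i (compareInstances m p))) :
    (q 0 % 2 = 0 → {s | p s ≤ i}.Infinite → {s | p s = i + 1}.Infinite) ∧
      (q 0 % 2 = 1 → {s | p s = i + 1}.Infinite → {s | p s ≤ i}.Infinite) := by
  rcases hq with hq | hq
  · rw [mem_enumerated_compareInstances] at hq
    constructor
    · intro h0 h
      obtain ⟨s, hs, hle⟩ := h.exists_gt (q 0)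
      exact absurd ⟨s, hle.le, Or.inl ⟨h0, hs⟩⟩ hq
    · intro h1 h
      obtain ⟨s, hs, hle⟩ := h.exists_gt (q 0)
      exact absurd ⟨s, hle.le, Or.inr ⟨h1, hs⟩⟩ hq
  · have hall : ∀ v, ∃ s, v ≤ s ∧ ((v % 2 = 0 ∧ p s ≤ i) ∨ (v % 2 = 1 ∧ p s = i + 1)) := fun v =>
      (mem_enumerated_compareInstances i p v).1 (hq ▸ mem_univ v)
    constructor
    · refine fun _ _ => infinite_of_forall_exists_gt fun b => ?_
      obtain ⟨s, hs, h | h⟩ := hall (2 * b + 1)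
      · omega
      · exact ⟨s, h.2, by omega⟩
    · refine fun _ _ => infinite_of_forall_exists_gt fun b => ?_
      obtain ⟨s, hs, h | h⟩ := hall (2 * b + 2)
      · exact ⟨s, h.2, by omega⟩
      · omega

theorem cRT_reducible_power_TCN {k m : ℕ} (hkm : k ≤ m) :
    WeihrauchReducible (cRT (k + 1)) (power TCN m) := by
  -- In `pair z x` the first entries of the answers, `z 0, …, z (m - 1)`, are at even positions.
  refine ⟨_, _, computableFunctional_of_local (compareEntry m) (primrec_compareEntry m) 0
      fun t u v h ht => compareEntry_of_prefix m t h ht,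
    computableFunctional_of_local (fun _ w => lastEven (fun i => w.getD (2 * i) 0) m)
      ((primrec_lastEven m).comp Primrec.snd) (2 * m)
      fun t u v h ht => lastEven_congr fun i hi => getD_eq_of_prefix h (by omega), ?_⟩
  rintro F hF x ⟨-, hx, -⟩
  obtain ⟨z, hz, hzmem⟩ := hF (compareInstances m x) (power_TCN_nonempty m _)
  have hsol := fun i : Fin m => infinite_of_mem_TCN i x _ (hzmem i)
  have hcomp : ∀ i : Fin m, component m i z 0 = z i := fun i => by simp [component]
  simp only [hcomp] at hsol
  have hinf : {s | x s = lastEven z m}.Infinite := by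
    refine infinite_lastEven x z m ?_ (fun i hi => (hsol ⟨i, hi⟩).1) fun i hi => (hsol ⟨i, hi⟩).2
    have huniv : {s | x s ≤ m} = univ := eq_univ_of_forall fun s => by
      have := hx s
      simp only [mem_ofPred_eq]
      omega
    exact huniv ▸ infinite_univ
  refine ⟨_, Part.mem_bind (Part.mem_some _) (Part.mem_bind hz (Part.mem_some _)), hx, ?_⟩
  have hval : lastEven (fun i => (pre (pair z x) (0 + 2 * m + 1)).getD (2 * i) 0) m
      = lastEven z m := by
    refine lastEven_congr fun i hi => ?_
    rw [getD_pre (by omega)]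
    simp [pair]
  simp only [hval]
  obtain ⟨s, hs⟩ := hinf.nonempty
  exact ⟨hs ▸ hx s, hinf⟩

/-! ### Extensions of words by a restricted set of colours -/

section Extensions

variable {k m : ℕ}

/-- The colourings that agree with `x` on the first `l` positions and take colours in `C` from
there on. -/
def extensions (x : ℕ → Fin (k + 1)) (l : ℕ) (C : Finset (Fin (k + 1))) :
    Set (ℕ → Fin (k + 1)) :=
  {y | (∀ i < l, y i = x i) ∧ ∀ i, l ≤ i → y i ∈ C}

theorem extensions_subset {x y : ℕ → Fin (k + 1)} {l l' : ℕ} {C C' : Finset (Fin (k + 1))}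
    (hy : y ∈ extensions x l C) (hl : l ≤ l') (hC : C' ⊆ C) :
    extensions y l' C' ⊆ extensions x l C := by
  refine fun z hz => ⟨fun i hi => (hz.1 i (by omega)).trans (hy.1 i hi), fun i hi => ?_⟩
  by_cases h : i < l'
  · exact hz.1 i h ▸ hy.2 i hi
  · exact hC (hz.2 i (by omega))

theorem extensions_nonempty (x : ℕ → Fin (k + 1)) (l : ℕ) {C : Finset (Fin (k + 1))}
    (hC : C.Nonempty) : (extensions x l C).Nonempty := by
  obtain ⟨c, hc⟩ := hC
  exact ⟨fun i => if i < l then x i else c, fun i hi => if_pos hi, fun i hi => by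
    simpa [not_lt.2 hi] using hc⟩

theorem isClosed_extensions (x : ℕ → Fin (k + 1)) (l : ℕ) (C : Finset (Fin (k + 1))) :
    IsClosed (extensions x l C) := by
  have h : extensions x l C =
      (⋂ i, {y | i < l → y i = x i}) ∩ ⋂ i, {y | l ≤ i → y i ∈ C} := by
    ext y
    simp [extensions]
  rw [h]
  refine (isClosed_iInter fun i => ?_).inter (isClosed_iInter fun i => ?_)
  · exact (isClosed_discrete {c : Fin (k + 1) | i < l → c = x i}).preimage
      (continuous_apply (A := fun _ => Fin (k + 1)) i)
  · exact (isClosed_discrete {c : Fin (k + 1) | l ≤ i → c ∈ C}).preimage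
      (continuous_apply (A := fun _ => Fin (k + 1)) i)

/-- Baire category: countably many open sets that meet all extensions of longer words have a
common point. -/
theorem exists_mem_extensions_forall {ι : Type*} [Countable ι] (U : ι → Set (ℕ → Fin (k + 1)))
    (hU : ∀ j, IsOpen (U j)) (x : ℕ → Fin (k + 1)) (l : ℕ) {C : Finset (Fin (k + 1))}
    (hC : C.Nonempty)
    (hmeet : ∀ j, ∀ y ∈ extensions x l C, ∀ l', l ≤ l' → ∃ z ∈ extensions y l' C, z ∈ U j) :
    ∃ z ∈ extensions x l C, ∀ j, z ∈ U j := by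
  have : CompactSpace (extensions x l C) :=
    isCompact_iff_compactSpace.1 (isClosed_extensions x l C).isCompact
  have : Nonempty (extensions x l C) := (extensions_nonempty x l hC).to_subtype
  have hdense : Dense (⋂ j, ((↑) : extensions x l C → ℕ → Fin (k + 1)) ⁻¹' U j) := by
    refine dense_iInter_of_isOpen (fun j => (hU j).preimage continuous_subtype_val) fun j => ?_
    rw [dense_iff_inter_open]
    rintro V hV ⟨⟨y, hy⟩, hyV⟩
    obtain ⟨W, hW, rfl⟩ := isOpen_induced_iff.1 hV
    obtain ⟨_, ⟨y', n, rfl⟩, hyn, hsub⟩ :=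
      (PiNat.isTopologicalBasis_cylinders _).exists_subset_of_mem_open
        (show y ∈ W from hyV) hW
    obtain ⟨z, hz, hzU⟩ := hmeet j y hy (max l n) (le_max_left _ _)
    refine ⟨⟨z, extensions_subset hy (le_max_left _ _) subset_rfl hz⟩, hsub ?_, hzU⟩
    exact fun i hi => (hz.1 i (lt_max_of_lt_right hi)).trans (hyn i hi)
  obtain ⟨z, hz⟩ := hdense.nonempty
  exact ⟨z, z.2, fun j => mem_iInter.1 hz j⟩

/-- The tuple `N` answers all instances of `TCN` that are attached to `x`, where `x ∈ E i n` says
that the `i`-th instance enumerates `n`. -/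
def Solves (E : Fin m → ℕ → Set (ℕ → Fin (k + 1))) (N : Fin m → ℕ) (x : ℕ → Fin (k + 1)) : Prop :=
  ∀ i, x ∉ E i (N i) ∨ ∀ n, x ∈ E i n

/-- Suppose that a colour occurring infinitely often can be read off continuously from a
colouring together with correct answers. If the instances in `S` have answers in `N` that are
correct on all extensions of a word by colours from `C`, then `C` has at most one colour more than
there are instances outside `S`. -/
theorem no_reduction_of_extensions (E : Fin m → ℕ → Set (ℕ → Fin (k + 1)))
    (hE : ∀ i n, IsOpen (E i n))
    (hcommit : ∀ N x, Solves E N x → ∃ c : Fin (k + 1), ∃ l, ∀ y, (∀ i < l, y i = x i) →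
      Solves E N y → {i | y i = c}.Infinite)
    (S : Finset (Fin m)) (N : Fin m → ℕ) (x : ℕ → Fin (k + 1)) (l : ℕ)
    (C : Finset (Fin (k + 1))) (hC : Sᶜ.card + 2 ≤ C.card)
    (hN : ∀ i ∈ S, ∀ y ∈ extensions x l C, y ∉ E i (N i)) : False := by
  induction hd : Sᶜ.card using Nat.strong_induction_on generalizing S N x l C with
  | _ d ih =>
  by_cases hext : ∃ i ∉ S, ∃ n, ∃ y ∈ extensions x l C, ∃ l', l ≤ l' ∧ ∃ C' ⊆ C,
      C.card ≤ C'.card + 1 ∧ ∀ z ∈ extensions y l' C', z ∉ E i n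
  · -- A further instance gets a permanently correct answer, at the price of at most one colour.
    obtain ⟨i, hi, n, y, hy, l', hl, C', hC', hcard, hz⟩ := hext
    have hlt : (insert i S)ᶜ.card + 1 = Sᶜ.card := by
      rw [Finset.compl_insert]
      exact Finset.card_erase_add_one (Finset.mem_compl.2 hi)
    refine ih _ (by omega) (insert i S) (Function.update N i n) y l' C' (by omega) ?_ rfl
    intro j hj z hzmem
    by_cases hji : j = i
    · subst hji
      simpa using hz z hzmem
    · rw [Function.update_of_ne hji]
      exact hN j ((Finset.mem_insert.1 hj).resolve_left hji) z (extensions_subset hy hl hC' hzmem)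
  · push Not at hext
    have hgen : ∀ y ∈ extensions x l C, ∀ l', l ≤ l' → ∀ C' ⊆ C, C.card ≤ C'.card + 1 →
        ∃ z ∈ extensions y l' C', Solves E N z := by
      intro y hy l' hl C' hC' hcard
      obtain ⟨z, hz, hzE⟩ := exists_mem_extensions_forall
        (fun j : {i // i ∉ S} × ℕ => E j.1 j.2) (fun j => hE _ _) y l'
        (Finset.card_pos.1 (by omega : 0 < C'.card)) fun j y' hy' l'' hl' =>
          hext j.1 j.1.2 j.2 y' (extensions_subset hy hl hC' hy') l'' (hl.trans hl') C' hC' hcard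
      refine ⟨z, hz, fun i => ?_⟩
      by_cases hi : i ∈ S
      · exact Or.inl (hN i hi z (extensions_subset hy hl hC' hz))
      · exact Or.inr fun n => hzE (⟨i, hi⟩, n)
    obtain ⟨y, hy⟩ := extensions_nonempty x l (Finset.card_pos.1 (by omega : 0 < C.card))
    obtain ⟨z, hz, hzN⟩ := hgen y hy l le_rfl C subset_rfl (by omega)
    obtain ⟨c, L, hc⟩ := hcommit N z hzN
    -- Give up the colour `c` to which `z` is committed by its first `L` entries.
    obtain ⟨z', hz', hzN'⟩ := hgen z (extensions_subset hy le_rfl subset_rfl hz) (max l L)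
      (le_max_left _ _) (C.erase c) (Finset.erase_subset _ _) (by
        have := Finset.pred_card_le_card_erase (s := C) (a := c)
        omega)
    obtain ⟨i, hi, hlt⟩ := (hc z' (fun i hi => hz'.1 i (lt_max_of_lt_right hi)) hzN').exists_gt
      (max l L)
    exact Finset.ne_of_mem_erase (hz'.2 i hlt.le) hi

end Extensions

/-! ### Irreducibility -/

/-- A colouring with colours in `Fin (k + 1)` as an instance of `cRT (k + 1)`. -/
def colouring {k : ℕ} (x : ℕ → Fin (k + 1)) : Baire := fun i => x i

theorem colouring_mem_dom {k : ℕ} (x : ℕ → Fin (k + 1)) :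
    colouring x ∈ Problem.dom (cRT (k + 1)) := by
  obtain ⟨c, hc⟩ := Finite.exists_infinite_fiber x
  refine ⟨fun _ => c, fun i => (x i).2, c.2, ?_⟩
  convert infinite_coe_iff.1 hc using 1
  ext i
  simp [colouring, Fin.ext_iff]

theorem pre_pair_congr {z x y : Baire} {l : ℕ} (h : ∀ i < l, y i = x i) :
    pre (pair z y) l = pre (pair z x) l := by
  refine pre_congr fun i hi => ?_
  simp only [pair]
  split_ifs
  · rfl
  · exact h _ (by omega)

theorem le_of_cRT_reducible_power_TCN {k m : ℕ}
    (h : WeihrauchReducible (cRT (k + 1)) (power TCN m)) : k ≤ m := by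
  obtain ⟨H, K, ⟨_, -, -, hHspec⟩, ⟨_, -, -, hKspec⟩, hred⟩ := h
  by_contra! hlt
  choose sol hsol using power_TCN_nonempty m
  -- A realizer of `power TCN m` may return any correct tuple, so `K` has to handle all of them.
  have hanswer : ∀ x : ℕ → Fin (k + 1), ∃ p ∈ H (colouring x), ∀ z ∈ power TCN m p,
      ∃ y ∈ K (pair z (colouring x)), y ∈ cRT (k + 1) (colouring x) := by
    intro x
    obtain ⟨_, hy, -⟩ := hred (fun p => Part.some (sol p))
      (fun p _ => ⟨sol p, Part.mem_some _, hsol p⟩) _ (colouring_mem_dom x)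
    obtain ⟨p, hp, -⟩ := Part.mem_bind_iff.1 hy
    refine ⟨p, hp, fun z hz => ?_⟩
    classical
    obtain ⟨y, hy, hymem⟩ := hred (fun p' => Part.some (if p' = p then z else sol p'))
      (fun p' _ => ⟨_, Part.mem_some _, by
        split_ifs with hpp
        · exact hpp ▸ hz
        · exact hsol p'⟩) _ (colouring_mem_dom x)
    obtain ⟨p', hp', hyF⟩ := Part.mem_bind_iff.1 hy
    obtain rfl := Part.mem_unique hp hp'
    obtain ⟨z', hz', hyK⟩ := Part.mem_bind_iff.1 hyF
    rw [if_pos rfl] at hz'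
    obtain rfl := Part.mem_some_iff.1 hz'
    exact ⟨y, hyK, hymem⟩
  choose p hp hpK using hanswer
  let E : Fin m → ℕ → Set (ℕ → Fin (k + 1)) := fun i n =>
    {x | n ∈ enumerated (component m i (p x))}
  have hsolves : ∀ N x, Solves E N x → answerName N ∈ power TCN m (p x) := by
    intro N x hN i
    refine (hN i).imp (fun h => ?_) fun h => eq_univ_of_forall h
    rw [component_answerName_zero]
    exact h
  refine no_reduction_of_extensions E ?_ ?_ ∅ 0 0 0 Finset.univ ?_ (by simp)
  · -- Each entry of `H x` is determined by finitely many entries of `x`.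
    intro i n
    refine (PiNat.isTopologicalBasis_cylinders _).isOpen_iff.2 ?_
    rintro x ⟨a, ha⟩
    obtain ⟨hpre, hlen⟩ := hHspec _ _ (hp x)
    obtain ⟨l, hl⟩ := hlen (m * a + i + 1)
    refine ⟨_, ⟨x, l, rfl⟩, PiNat.self_mem_cylinder x l, fun y hy => ⟨a, ?_⟩⟩
    have hxy : pre (colouring y) l = pre (colouring x) l :=
      pre_congr fun i hi => congrArg Fin.val (hy i hi)
    have hy' := (hHspec _ _ (hp y)).1 l
    rw [hxy, hpre l] at hy'
    rw [length_pre] at hy'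
    have := congrArg (·[m * a + i]?) hy'
    simp only [getElem?_pre (show m * a + i < _ from hl), Option.some_inj] at this
    exact this.symm.trans ha
  · -- The first entry of the output of `K` is determined by finitely many entries of its input.
    intro N x hN
    obtain ⟨q, hq, -, hlt, -⟩ := hpK x _ (hsolves N x hN)
    obtain ⟨hpre, hlen⟩ := hKspec _ _ hq
    obtain ⟨l, hl⟩ := hlen 1
    refine ⟨⟨q 0, hlt⟩, l, fun y hy hNy => ?_⟩
    obtain ⟨r, hr, -, -, hinf'⟩ := hpK y _ (hsolves N y hNy)
    have hr' := (hKspec _ _ hr).1 l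
    rw [pre_pair_congr (x := colouring x) (y := colouring y) fun i hi => congrArg Fin.val (hy i hi),
      hpre l, length_pre] at hr'
    have := congrArg (·[0]?) hr'
    simp only [getElem?_pre (show 0 < _ from hl), Option.some_inj] at this
    rw [← this] at hinf'
    convert hinf' using 1
    ext i
    simp [colouring, Fin.ext_iff]
  · simpa using by omega

end Weihrauch

theorem mainTheorem4 (k m : ℕ) :
    Weihrauch.WeihrauchReducible (Weihrauch.cRT (k + 1)) (Weihrauch.power Weihrauch.TCN m) ↔
      k ≤ m :=
  ⟨Weihrauch.le_of_cRT_reducible_power_TCN, Weihrauch.cRT_reducible_power_TCN⟩
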